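/- Let $M$ be a compact complex manifold of dimension $n$ with a Kähler form $\omega$ (a smooth closed positive $(1,1)$-form), let $\Omega=\frac1{n!}\omega^{\wedge n}$, and let $(L,h)$ be a holomorphic line bundle on $M$ with a smooth hermitian metric $h$ (conjugate linear in the first argument). Let $\nabla$ be the unique connection on $L$ compatible with the metric and the complex structure, and assume the quantization condition $\nabla_X\nabla_Y-\nabla_Y\nabla_X-\nabla_{[X,Y]}=-\mathrm i\,\omega(X,Y)$ for all vector fields $X,Y$. Assume that $L$ is very ample, i.e. its global holomorphic sections embed $M$ into a projective space. Equip the space of smooth sections of $L$ with the scalar product $\langle\varphi,\psi\rangle=\int_M h(\varphi,\psi)\,\Omega$, let $\mathrm L^2(M,L)$ be its completion, and let $\Gamma_{hol}(M,L)$ be the subspace of holomorphic sections. Then $\Gamma_{hol}(M,L)$ is finite-dimensional, so that the following objects are defined: * for $f\in C^\infty(M)$ (complex-valued), the Toeplitz operator $T_f\in\mathrm{End}(\Gamma_{hol}(M,L))$, $T_f s=\Pi(f s)$, where $\Pi:\mathrm L^2(M,L)\to\Gamma_{hol}(M,L)$ is the orthogonal projection; * for $x\in M$ and $0\neq q\in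 L_x$, the coherent vector $e_q\in\Gamma_{hol}(M,L)$ determined by $s(x)=\langle e_q,s\rangle\, q$ for all $s\in\Gamma_{hol}(M,L)$; the function $\epsilon(x)=h(q,q)\,\langle e_q,e_q\rangle$; and the projector $P_x=\frac{|e_q\rangle\langle e_q|}{\langle e_q,e_q\rangle}$. The last two do not depend on the choice of $q\ne 0$ in $L_x$; * for $A\in\mathrm{End}(\Gamma_{hol}(M,L))$, the covariant Berezin symbol $\sigma(A):M\to\mathbb C$, $\sigma(A)(x)=\mathrm{Tr}(A P_x)$. The function $\epsilon$ is continuous and strictly positive, and $\sigma(A)\in C^\infty(M)$ for every $A$. Put $\Omega_\epsilon=\epsilon\,\Omega$, $\langle u,v\rangle_\epsilon=\int_M \overline{u}\,v\,\Omega_\epsilon$ for functions $u,v\in C^\infty(M)$, and $\langle A,C\rangle_{HS}=\mathrm{Tr}(A^*C)$ for $A,C\in\mathrm{End}(\Gamma_{hol}(M,L))$. Then the maps $f\mapsto T_f$ and $A\mapsto\sigma(A)$ are adjoint: for all $A\in\mathrm{End}(\Gamma_{hol}(M,L))$ and all $f\in C^\infty(M)$ the function $\overline{\sigma(A)}\,f$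 is integrable with respect to $\Omega_\epsilon$ and $$\langle A,T_f\rangle_{HS}=\langle\sigma(A),f\rangle_\epsilon .$$ -/

import Mathlib

open scoped Manifold ContDiff Bundle ComplexConjugate
noncomputable section
namespace BerezinToeplitz
open MeasureTheory Bundle

/-- The model space `ℂⁿ` of a complex manifold of dimension `n`. As a product of copies of `ℂ` it carries
the Lebesgue measure `dx₁dy₁⋯dxₙdyₙ` as `volume`. -/
abbrev Model (n : ℕ) : Type := Fin n → ℂ

theorem cons_update_zero {n : ℕ} (v : Fin n × Fin 2 → Model n) [DecidableEq (Fin n × Fin 2)]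
    (i : Fin n × Fin 2) (x : Model n) (j : Fin n) :
    (![Function.update v i x (j, 0), Function.update v i x (j, 1)] : Fin 2 → Model n) =
      if j = i.1 then Function.update ![v (j, 0), v (j, 1)] i.2 x else ![v (j, 0), v (j, 1)] := by
  obtain ⟨a, b⟩ := i
  by_cases h : j = a
  · subst h
    ext k l
    fin_cases b <;> fin_cases k <;> simp
  · simp [h]

/-- The multilinear form `α ⊗ ⋯ ⊗ α` (`n` factors): the `2n` arguments, indexed by `(j, 0)` and
`(j, 1)`, are fed pairwise into the 2-form `α`. -/
def powerTerm {n : ℕ} (α : Model n [⋀^Fin 2]→L[ℝ] ℝ) :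
    MultilinearMap ℝ (fun _ : Fin n × Fin 2 => Model n) ℝ where
  toFun v := ∏ j, α ![v (j, 0), v (j, 1)]
  map_update_add' v i x y := by
    simp only [cons_update_zero]
    rw [← Finset.mul_prod_erase _ _ (Finset.mem_univ i.1),
      ← Finset.mul_prod_erase _ _ (Finset.mem_univ i.1),
      ← Finset.mul_prod_erase _ _ (Finset.mem_univ i.1)]
    simp only [if_true, α.map_update_add, add_mul]
    congr 2 <;> refine Finset.prod_congr rfl fun j hj => ?_ <;> simp [Finset.ne_of_mem_erase hj]
  map_update_smul' v i c x := by
    simp only [cons_update_zero]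
    rw [← Finset.mul_prod_erase _ _ (Finset.mem_univ i.1),
      ← Finset.mul_prod_erase _ _ (Finset.mem_univ i.1)]
    simp only [if_true, α.map_update_smul, smul_mul_assoc]
    congr 2; refine Finset.prod_congr rfl fun j hj => ?_; simp [Finset.ne_of_mem_erase hj]

/-- The top degree form `α^{∧n} / n!` of a real 2-form `α` on `ℂⁿ`, where
`α^{∧n}(v) = 2⁻ⁿ ∑_σ sign(σ) ∏_j α(v_{σ(j,0)}, v_{σ(j,1)})`, so that `dx ∧ dy (∂x, ∂y) = 1`. -/
def topPower {n : ℕ} (α : Model n [⋀^Fin 2]→L[ℝ] ℝ) :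
    Model n [⋀^(Fin n × Fin 2)]→ₗ[ℝ] ℝ :=
  ((n.factorial * 2 ^ n : ℝ)⁻¹) • MultilinearMap.alternatization (powerTerm α)

theorem topPower_apply {n : ℕ} (α : Model n [⋀^Fin 2]→L[ℝ] ℝ) (v : Fin n × Fin 2 → Model n) :
    topPower α v = (n.factorial * 2 ^ n : ℝ)⁻¹ * ∑ σ : Equiv.Perm (Fin n × Fin 2),
      (Equiv.Perm.sign σ : ℝ) * ∏ j, α ![v (σ (j, 0)), v (σ (j, 1))] := by
  simp only [topPower, AlternatingMap.smul_apply, MultilinearMap.alternatization_apply, smul_eq_mul,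
    MultilinearMap.domDomCongr_apply]
  congr 1
  refine Finset.sum_congr rfl fun σ _ => ?_
  simp only [powerTerm, MultilinearMap.coe_mk, Units.smul_def, zsmul_eq_mul]

/-- The positively oriented real coordinate frame `∂x₁, ∂y₁, …, ∂xₙ, ∂yₙ` of `ℂⁿ`. -/
def coordVec {n : ℕ} (a : Fin n × Fin 2) : Model n :=
  Pi.single a.1 (if a.2 = 0 then 1 else Complex.I)

theorem coordVec_apply_eq {n : ℕ} (a b : Fin n × Fin 2) :
    (∑ j, ((conj (coordVec a j) * coordVec b j).im)) =
      if a.1 = b.1 then (if a.2 = b.2 then 0 else if a.2 = 0 then 1 else -1) else 0 := by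
  obtain ⟨a, i⟩ := a
  obtain ⟨b, j⟩ := b
  by_cases h : a = b
  · subst h
    rw [Finset.sum_eq_single a]
    · fin_cases i <;> fin_cases j <;> simp [coordVec]
    · intro b _ hb; simp [coordVec, hb]
    · simp
  · simp only [h, if_false]
    refine Finset.sum_eq_zero fun l _ => ?_
    by_cases hl : l = a
    · subst hl; simp [coordVec, h]
    · simp [coordVec, hl]

theorem sum_sign_pos {n : ℕ} (S : Fin n × Fin 2 → Fin n × Fin 2 → ℝ)
    (hS : ∀ a b, S a b =
      if a.1 = b.1 then (if a.2 = b.2 then 0 else if a.2 = 0 then 1 else -1) else 0) :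
    0 < ∑ σ : Equiv.Perm (Fin n × Fin 2),
      (Equiv.Perm.sign σ : ℝ) * ∏ j, S (σ (j, 0)) (σ (j, 1)) := by
  refine Finset.sum_pos' (fun σ _ => ?_) ⟨1, Finset.mem_univ _, by simp [hS]⟩
  by_cases hz : ∏ j, S (σ (j, 0)) (σ (j, 1)) = 0
  · simp [hz]
  rw [← ne_eq, Finset.prod_ne_zero_iff] at hz
  have h1 : ∀ j, (σ (j, 0)).1 = (σ (j, 1)).1 := fun j => by
    by_contra h; exact hz j (Finset.mem_univ _) (by simp [hS, h])
  have h2 : ∀ j, (σ (j, 0)).2 ≠ (σ (j, 1)).2 := fun j h =>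
    hz j (Finset.mem_univ _) (by simp [hS, h])
  have hτ : ∀ j, Function.Injective (fun b : Fin 2 => (σ (j, b)).2) := by
    intro j a b hab
    have := h2 j
    fin_cases a <;> fin_cases b
    · rfl
    · exact absurd hab this
    · exact absurd hab.symm this
    · rfl
  let τ : Fin n → Equiv.Perm (Fin 2) := fun j =>
    Equiv.ofBijective _ (Finite.injective_iff_bijective.1 (hτ j))
  have h1' : ∀ j b, (σ (j, b)).1 = (σ (j, 0)).1 := by
    intro j b; fin_cases b
    · rfl
    · exact (h1 j).symm
  have hp : Function.Injective (fun j : Fin n => (σ (j, 0)).1) := by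
    intro j k hjk
    obtain ⟨b, hb⟩ := (τ k).surjective (σ (j, 0)).2
    have : σ (j, 0) = σ (k, b) := Prod.ext (by rw [h1' k b]; exact hjk) hb.symm
    exact congrArg Prod.fst (σ.injective this)
  let p : Equiv.Perm (Fin n) := Equiv.ofBijective _ (Finite.injective_iff_bijective.1 hp)
  have hσ : σ = (Equiv.prodCongrLeft (fun _ : Fin 2 => p)) * (Equiv.prodCongrRight τ) := by
    ext1 ⟨j, b⟩
    refine Prod.ext ?_ ?_
    · exact h1' j b
    · rfl
  have hs : (Equiv.Perm.sign σ : ℝ) = ∏ j, (Equiv.Perm.sign (τ j) : ℝ) := by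
    rw [hσ, Equiv.Perm.sign_mul, Equiv.Perm.sign_prodCongrLeft, Equiv.Perm.sign_prodCongrRight]
    simp
  rw [hs, ← Finset.prod_mul_distrib]
  refine Finset.prod_nonneg fun j _ => ?_
  rw [hS, if_pos (h1 j), if_neg (h2 j)]
  have hτ0 : τ j 0 = (σ (j, 0)).2 := rfl
  rw [← hτ0]
  have ht : ∀ t : Equiv.Perm (Fin 2), Equiv.Perm.sign t = if t 0 = 0 then 1 else -1 := by decide
  rw [ht (τ j)]
  split_ifs <;> simp

theorem topPower_comp {n : ℕ} (α : Model n [⋀^Fin 2]→L[ℝ] ℝ) (g : Model n →L[ℝ] Model n)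
    (v : Fin n × Fin 2 → Model n) :
    topPower (α.compContinuousLinearMap g) v = topPower α (g ∘ v) := by
  simp only [topPower_apply, ContinuousAlternatingMap.compContinuousLinearMap_apply,
    Function.comp_apply]
  congr 1
  refine Finset.sum_congr rfl fun σ _ => ?_
  congr 1
  refine Finset.prod_congr rfl fun j _ => ?_
  congr 1
  ext k
  fin_cases k <;> rfl

/-- The frame `coordVec` as a real basis of `ℂⁿ`. -/
def coordBasis (n : ℕ) : Module.Basis (Fin n × Fin 2) ℝ (Model n) :=
  (Pi.basis (fun _ : Fin n => Complex.basisOneI)).reindex (Equiv.sigmaEquivProd _ _)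

theorem coe_coordBasis (n : ℕ) : ⇑(coordBasis n) = coordVec := by
  ext1 ⟨j, b⟩
  simp only [coordBasis, Module.Basis.reindex_apply, Equiv.sigmaEquivProd_symm_apply,
    Pi.basis_apply, coordVec, Complex.coe_basisOneI]
  fin_cases b <;> rfl

theorem topPower_map {n : ℕ} (α : Model n [⋀^Fin 2]→L[ℝ] ℝ) (g : Model n →ₗ[ℝ] Model n) :
    topPower α (g ∘ coordVec) = LinearMap.det g * topPower α coordVec := by
  rw [(topPower α).eq_smul_basis_det (coordBasis n)]
  simp only [AlternatingMap.smul_apply, smul_eq_mul, coe_coordBasis]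
  rw [Module.Basis.det_comp]
  ring

open scoped MatrixOrder ComplexOrder Matrix in
theorem topPower_pos {n : ℕ} (α : Model n [⋀^Fin 2]→L[ℝ] ℝ)
    (h11 : ∀ v w : Model n, α ![Complex.I • v, Complex.I • w] = α ![v, w])
    (hpos : ∀ v : Model n, v ≠ 0 → 0 < α ![v, Complex.I • v]) :
    0 < topPower α coordVec := by
  have e0 : ∀ u v x : Model n, Function.update ![u, v] 0 x = ![x, v] := fun u v x => by
    ext k; fin_cases k <;> rfl
  have e1 : ∀ u v x : Model n, Function.update ![u, v] 1 x = ![u, x] := fun u v x => by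
    ext k; fin_cases k <;> rfl
  have hadd1 : ∀ u v w, α ![u + v, w] = α ![u, w] + α ![v, w] := fun u v w => by
    simpa only [e0] using α.map_update_add ![u, w] 0 u v
  have hadd2 : ∀ u v w, α ![u, v + w] = α ![u, v] + α ![u, w] := fun u v w => by
    simpa only [e1] using α.map_update_add ![u, w] 1 v w
  have hsm1 : ∀ (c : ℝ) u v, α ![c • u, v] = c * α ![u, v] := fun c u v => by
    simpa only [e0, smul_eq_mul] using α.map_update_smul ![u, v] 0 c u
  have hsm2 : ∀ (c : ℝ) u v, α ![u, c • v] = c * α ![u, v] := fun c u v => by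
    simpa only [e1, smul_eq_mul] using α.map_update_smul ![u, v] 1 c v
  have hanti : ∀ u v, α ![u, v] = - α ![v, u] := fun u v => by
    have h : ∀ x, α ![x, x] = 0 := fun x =>
      α.map_eq_zero_of_eq ![x, x] (i := 0) (j := 1) rfl (by decide)
    have := h (u + v)
    rw [hadd1, hadd2, hadd2, h, h] at this
    linarith
  have hI : ∀ u v, α ![Complex.I • u, v] = - α ![u, Complex.I • v] := fun u v => by
    rw [← h11 u, smul_smul, Complex.I_mul_I]
    have := hsm2 (-1) (Complex.I • u) v
    simp only [neg_smul, one_smul, neg_mul, one_mul] at this ⊢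
    rw [this, neg_neg]
  have hII : ∀ u v, α ![u, Complex.I • Complex.I • v] = - α ![u, v] := fun u v => by
    rw [smul_smul, Complex.I_mul_I]
    simpa using hsm2 (-1) u v
  let H : Model n →ₗ⋆[ℂ] Model n →ₗ[ℂ] ℂ := LinearMap.mk₂'ₛₗ (starRingEnd ℂ) (RingHom.id ℂ)
    (fun v w => (α ![v, Complex.I • w] : ℂ) + Complex.I * (α ![v, w] : ℂ))
    (fun u v w => by simp only [hadd1]; push_cast; ring)
    (fun c u v => by
      have hc : c • u = c.re • u + c.im • Complex.I • u := by
        ext j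
        simp only [Pi.add_apply, Pi.smul_apply, Complex.real_smul, smul_eq_mul]
        conv_lhs => rw [← Complex.re_add_im c]
        ring
      have hc' : conj c = c.re - c.im * Complex.I := by
        apply Complex.ext <;> simp
      rw [hc]
      simp only [hadd1, hsm1, hI, hII, smul_eq_mul, hc']
      push_cast
      linear_combination (c.im * (α ![u,v]:ℂ)) * Complex.I_mul_I)
    (fun u v w => by simp only [smul_add, hadd2]; push_cast; ring)
    (fun c u v => by
      have hc : c • v = c.re • v + c.im • Complex.I • v := by
        ext j
        simp only [Pi.add_apply, Pi.smul_apply, Complex.real_smul, smul_eq_mul]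
        conv_lhs => rw [← Complex.re_add_im c]
        ring
      have hc' : c = c.re + c.im * Complex.I := (Complex.re_add_im c).symm
      rw [hc]
      simp only [smul_add, smul_comm Complex.I (_ : ℝ), hadd2, hsm2, hII, smul_eq_mul]
      conv_rhs => rw [RingHom.id_apply, hc']
      push_cast
      linear_combination (- c.im * (α ![u,v]:ℂ)) * Complex.I_mul_I)
  have hH : ∀ v w, H v w = (α ![v, Complex.I • w] : ℂ) + Complex.I * (α ![v, w] : ℂ) :=
    fun v w => rfl
  have hHim : ∀ v w, (H v w).im = α ![v, w] := fun v w => by simp [hH]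
  have hHre : ∀ v w, (H v w).re = α ![v, Complex.I • w] := fun v w => by simp [hH]
  let G : Matrix (Fin n) (Fin n) ℂ := fun j k => H (Pi.single j 1) (Pi.single k 1)
  have hG : ∀ v w, H v w = star v ⬝ᵥ (G *ᵥ w) := by
    intro v w
    conv_lhs => rw [pi_eq_sum_univ' v, pi_eq_sum_univ' w]
    simp only [map_sum, LinearMap.map_smulₛₗ, LinearMap.sum_apply, LinearMap.smul_apply,
      RingHom.id_apply, smul_eq_mul, dotProduct, Matrix.mulVec, G, Finset.mul_sum, Pi.star_apply]
    rw [Finset.sum_comm]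
    refine Finset.sum_congr rfl fun j _ => Finset.sum_congr rfl fun k _ => ?_
    simp only [starRingEnd_apply]
    ring_nf
  have hherm : ∀ v w, conj (H v w) = H w v := by
    intro v w
    apply Complex.ext
    · simp only [Complex.conj_re, hHre]; rw [hanti w, hI, neg_neg]
    · simp only [Complex.conj_im, hHim]; rw [hanti w, ]
  have hGpos : G.PosDef := by
    refine Matrix.PosDef.of_dotProduct_mulVec_pos ?_ ?_
    · ext j k
      exact hherm _ _
    · intro x hx
      rw [← hG, Complex.lt_def]
      refine ⟨by rw [hHre]; exact hpos x hx, ?_⟩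
      rw [hHim]
      have := hanti x x
      simp; linarith
  obtain ⟨B, hB⟩ := CStarAlgebra.nonneg_iff_eq_star_mul_self.1
    (Matrix.nonneg_iff_posSemidef.2 hGpos.posSemidef)
  have hBu : IsUnit B.det := by
    have := (Matrix.isUnit_iff_isUnit_det _).1 hGpos.isUnit
    rw [hB, Matrix.det_mul] at this
    exact isUnit_of_mul_isUnit_right this
  let g : Model n →ₗ[ℝ] Model n := (Matrix.toLin' B⁻¹).restrictScalars ℝ
  have key := topPower_map α g
  have h1 : 0 < topPower α (g ∘ coordVec) := by
    rw [topPower_apply]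
    refine mul_pos (by positivity) (sum_sign_pos (fun a b => α ![g (coordVec a), g (coordVec b)]) ?_)
    intro a b
    rw [← coordVec_apply_eq, ← hHim, hG, hB]
    have : star (g (coordVec a)) ⬝ᵥ ((star B * B) *ᵥ g (coordVec b)) =
        star (coordVec a) ⬝ᵥ coordVec b := by
      show star (B⁻¹ *ᵥ (coordVec a)) ⬝ᵥ ((star B * B) *ᵥ (B⁻¹ *ᵥ (coordVec b))) = _
      rw [Matrix.mulVec_mulVec, mul_assoc, Matrix.mul_nonsing_inv _ hBu, mul_one,
        Matrix.star_eq_conjTranspose, Matrix.dotProduct_mulVec, ← Matrix.star_mulVec,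
        Matrix.mulVec_mulVec, Matrix.mul_nonsing_inv _ hBu, Matrix.one_mulVec]
    rw [this]
    simp [dotProduct]
  rw [key, LinearMap.det_restrictScalars, Algebra.norm_complex_eq] at h1
  exact pos_of_mul_pos_right h1 (Complex.normSq_nonneg _)

section Form

variable {n : ℕ} {M : Type*} [TopologicalSpace M] [ChartedSpace (Model n) M]

/-- The expression of a 2-form on `M` in a chart `c`: its pullback under the inverse chart. -/
def localForm (form : ∀ x : M, TangentSpace 𝓘(ℝ, Model n) x [⋀^Fin 2]→L[ℝ] ℝ)
    (c : OpenPartialHomeomorph M (Model n)) (y : Model n) : Model n [⋀^Fin 2]→L[ℝ] ℝ :=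
  (form (c.symm y)).compContinuousLinearMap
    (mfderiv 𝓘(ℝ, Model n) 𝓘(ℝ, Model n) c.symm y)

variable (n M) in
/-- A Kähler form on the complex manifold `M`: a smooth closed positive real 2-form of type `(1,1)`.
All conditions are expressed in the charts of the (holomorphic) atlas; positivity says that
`ω(v, i v) > 0` for `v ≠ 0`, which contains nondegeneracy. -/
structure KahlerForm where
  /-- the 2-form, at every point a real alternating form on the tangent space -/
  form : ∀ x : M, TangentSpace 𝓘(ℝ, Model n) x [⋀^Fin 2]→L[ℝ] ℝ
  smooth : ∀ c ∈ atlas (Model n) M, ContDiffOn ℝ ∞ (localForm form c) c.target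
  closed : ∀ c ∈ atlas (Model n) M, ∀ y ∈ c.target, extDeriv (localForm form c) y = 0
  type_one_one : ∀ c ∈ atlas (Model n) M, ∀ y ∈ c.target, ∀ v w : Model n,
    localForm form c y ![Complex.I • v, Complex.I • w] = localForm form c y ![v, w]
  pos : ∀ c ∈ atlas (Model n) M, ∀ y ∈ c.target, ∀ v : Model n, v ≠ 0 →
    0 < localForm form c y ![v, Complex.I • v]

theorem contDiffOn_transition [IsManifold 𝓘(ℂ, Model n) ω M]
    {c c' : OpenPartialHomeomorph M (Model n)}
    (hc : c ∈ atlas (Model n) M) (hc' : c' ∈ atlas (Model n) M) :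
    ContDiffOn ℝ ∞ (c.symm ≫ₕ c') (c.symm ≫ₕ c').source := by
  have h1 := (HasGroupoid.compatible hc hc' :
    c.symm ≫ₕ c' ∈ contDiffGroupoid ω 𝓘(ℂ, Model n)).1
  have h2 : ContDiffOn ℂ ω (c.symm ≫ₕ c') (c.symm ≫ₕ c').source := by
    simpa [contDiffPregroupoid] using h1
  exact (h2.restrict_scalars ℝ).of_le le_top

theorem isManifold_real [IsManifold 𝓘(ℂ, Model n) ω M] : IsManifold 𝓘(ℝ, Model n) ∞ M :=
  isManifold_of_contDiffOn _ _ _ fun c c' hc hc' => by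
    simpa using contDiffOn_transition hc hc'

theorem localForm_transition [IsManifold 𝓘(ℂ, Model n) ω M]
    (form : ∀ x : M, TangentSpace 𝓘(ℝ, Model n) x [⋀^Fin 2]→L[ℝ] ℝ)
    {c c' : OpenPartialHomeomorph M (Model n)}
    (hc : c ∈ atlas (Model n) M) (hc' : c' ∈ atlas (Model n) M) {y : Model n}
    (hy : y ∈ (c.symm ≫ₕ c').source) :
    localForm form c y = (localForm form c' (c' (c.symm y))).compContinuousLinearMap
      (fderiv ℝ (c.symm ≫ₕ c') y) := by
  have : IsManifold 𝓘(ℝ, Model n) ∞ M := isManifold_real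
  have : IsManifold 𝓘(ℝ, Model n) 1 M := IsManifold.of_le (n := ∞) (by simp)
  have hy' : y ∈ c.target ∧ c.symm y ∈ c'.source := by simpa using hy
  have hpt : c'.symm (c' (c.symm y)) = c.symm y := c'.left_inv hy'.2
  have hder : mfderiv 𝓘(ℝ, Model n) 𝓘(ℝ, Model n) c.symm y =
      (mfderiv 𝓘(ℝ, Model n) 𝓘(ℝ, Model n) c'.symm (c' (c.symm y)) :
        Model n →L[ℝ] Model n).comp (fderiv ℝ (c.symm ≫ₕ c') y) := by
    have hev : c.symm =ᶠ[nhds y] c'.symm ∘ (c.symm ≫ₕ c') := by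
      filter_upwards [(c.symm ≫ₕ c').open_source.mem_nhds hy] with z hz
      have hz' : z ∈ c.target ∧ c.symm z ∈ c'.source := by simpa using hz
      simp [c'.left_inv hz'.2]
    refine hev.mfderiv_eq.trans ((mfderiv_comp (I' := 𝓘(ℝ, Model n)) y ?_ ?_).trans ?_)
    · exact mdifferentiableAt_atlas_symm hc' (c'.map_source hy'.2)
    · rw [mdifferentiableAt_iff_differentiableAt]
      exact ((contDiffOn_transition hc hc').contDiffAt
        ((c.symm ≫ₕ c').open_source.mem_nhds hy)).differentiableAt (by simp)
    · rw [mfderiv_eq_fderiv]; rfl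
  have aux : ∀ (x x' : M) (A A' : Model n →L[ℝ] Model n), x = x' → A = A' →
      ((form x : Model n [⋀^Fin 2]→L[ℝ] ℝ).compContinuousLinearMap A) =
      ((form x' : Model n [⋀^Fin 2]→L[ℝ] ℝ).compContinuousLinearMap A') := by
    rintro x _ A _ rfl rfl; rfl
  refine (aux _ _ _ _ hpt.symm hder).trans ?_
  rfl

/-- The measure on the domain of the chart `c` defined by the volume form `ω^{∧n} / n!`: its coefficient
in the coordinates times Lebesgue measure, transported to `M`. -/
def chartMeasure [MeasurableSpace M] (K : KahlerForm n M) (c : OpenPartialHomeomorph M (Model n)) : Measure M :=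
  ((volume.restrict c.target).withDensity
    (fun y => ENNReal.ofReal (topPower (localForm K.form c y) coordVec))).map c.symm

/-- The Liouville measure `Ω = ω^{∧n} / n!` on `M`. The measures of the single charts agree on overlaps,
so their supremum is the unique measure that restricts to each of them, see
`liouville_apply_of_subset_source`. -/
def liouville [MeasurableSpace M] (K : KahlerForm n M) : Measure M :=
  ⨆ c ∈ atlas (Model n) M, chartMeasure K c

theorem KahlerForm.density_pos (K : KahlerForm n M) {c : OpenPartialHomeomorph M (Model n)}
    (hc : c ∈ atlas (Model n) M) {y : Model n} (hy : y ∈ c.target) :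
    0 < topPower (localForm K.form c y) coordVec :=
  topPower_pos _ (K.type_one_one c hc y hy) (K.pos c hc y hy)

theorem KahlerForm.continuousOn_density (K : KahlerForm n M)
    {c : OpenPartialHomeomorph M (Model n)} (hc : c ∈ atlas (Model n) M) :
    ContinuousOn (fun y => topPower (localForm K.form c y) coordVec) c.target := by
  simp only [topPower_apply]
  refine continuousOn_const.mul (continuousOn_finsetSum _ fun σ _ => continuousOn_const.mul
    (continuousOn_finsetProd _ fun j _ => ?_))
  exact ((ContinuousAlternatingMap.apply ℝ (Model n) ℝ
    ![coordVec (σ (j, 0)), coordVec (σ (j, 1))]).continuous.comp_continuousOn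
    (K.smooth c hc).continuousOn)

variable [MeasurableSpace M] [BorelSpace M]

theorem chartMeasure_apply (K : KahlerForm n M) (c : OpenPartialHomeomorph M (Model n))
    {B : Set M} (hB : MeasurableSet B) :
    chartMeasure K c B = ∫⁻ y in c.target ∩ c.symm ⁻¹' B,
      ENNReal.ofReal (topPower (localForm K.form c y) coordVec) := by
  have hm : AEMeasurable c.symm (volume.restrict c.target) :=
    c.continuousOn_symm.aemeasurable c.open_target.measurableSet
  have hm' : NullMeasurableSet (c.symm ⁻¹' B) (volume.restrict c.target) :=
    hm.nullMeasurableSet_preimage hB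
  rw [chartMeasure, Measure.map_apply_of_aemeasurable (hm.mono_ac
    (withDensity_absolutelyContinuous _ _)) hB, withDensity_apply', Measure.restrict_restrict₀ hm',
    Set.inter_comm]

theorem chartMeasure_le [IsManifold 𝓘(ℂ, Model n) ω M] (K : KahlerForm n M)
    {c c' : OpenPartialHomeomorph M (Model n)}
    (hc : c ∈ atlas (Model n) M) (hc' : c' ∈ atlas (Model n) M)
    {B : Set M} (hB : MeasurableSet B) (hBc : B ⊆ c'.source) :
    chartMeasure K c B ≤ chartMeasure K c' B := by
  rw [chartMeasure_apply K c hB, chartMeasure_apply K c' hB]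
  have hmeas : MeasurableSet (c.target ∩ c.symm ⁻¹' B) := by
    have := (continuousOn_iff_continuous_domRestrict.1 c.continuousOn_symm).measurable hB
    have := c.open_target.measurableSet.subtype_image this
    convert this using 1
    ext z; simp [and_comm]
  set S := c.target ∩ c.symm ⁻¹' B
  have hS : S ⊆ (c.symm ≫ₕ c').source := fun y hy => by
    simpa using ⟨hy.1, hBc hy.2⟩
  have hder : ∀ y ∈ S, HasFDerivWithinAt (c.symm ≫ₕ c') (fderiv ℝ (c.symm ≫ₕ c') y) S y :=
    fun y hy => (((contDiffOn_transition hc hc').contDiffAt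
        ((c.symm ≫ₕ c').open_source.mem_nhds (hS hy))).differentiableAt
          (by simp)).hasFDerivAt.hasFDerivWithinAt
  have himg : (c.symm ≫ₕ c') '' S ⊆ c'.target ∩ c'.symm ⁻¹' B := by
    rintro _ ⟨y, hy, rfl⟩
    refine ⟨c'.map_source (hBc hy.2), ?_⟩
    simpa [c'.left_inv (hBc hy.2)] using hy.2
  refine le_trans (le_of_eq ?_) (lintegral_mono_set himg)
  rw [lintegral_image_eq_lintegral_abs_det_fderiv_mul volume hmeas hder
    ((c.symm ≫ₕ c').injOn.mono hS)]
  refine setLIntegral_congr_fun hmeas fun y hy => ?_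
  have hy' : c' (c.symm y) ∈ c'.target := c'.map_source (hBc hy.2)
  have hp := K.density_pos hc hy.1
  have hp' := K.density_pos hc' hy'
  have hden : topPower (localForm K.form c y) coordVec =
      (fderiv ℝ (c.symm ≫ₕ c') y).det *
        topPower (localForm K.form c' (c' (c.symm y))) coordVec := by
    rw [localForm_transition K.form hc hc' (hS hy), topPower_comp]
    exact topPower_map _ (fderiv ℝ (c.symm ≫ₕ c') y : Model n →ₗ[ℝ] Model n)
  have hdet : 0 < (fderiv ℝ (c.symm ≫ₕ c') y).det := by
    rw [hden] at hp
    exact pos_of_mul_pos_left hp hp'.le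
  show _ = _ * ENNReal.ofReal (topPower (localForm K.form c' (c' (c.symm y))) coordVec)
  rw [← ENNReal.ofReal_mul (abs_nonneg _), abs_of_pos hdet, hden]

theorem liouville_apply_of_subset_source [IsManifold 𝓘(ℂ, Model n) ω M] (K : KahlerForm n M)
    {c : OpenPartialHomeomorph M (Model n)} (hc : c ∈ atlas (Model n) M)
    {B : Set M} (hB : MeasurableSet B) (hBc : B ⊆ c.source) :
    liouville K B = chartMeasure K c B := by
  apply le_antisymm
  · have h : liouville K ≤ (chartMeasure K c).restrict c.source +
        (liouville K).restrict c.sourceᶜ := by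
      refine iSup₂_le fun c' hc' => Measure.le_iff.2 fun s hs => ?_
      have hsrc := c.open_source.measurableSet
      rw [← measure_inter_add_sdiff s hsrc, Measure.add_apply, Measure.restrict_apply hs,
        Measure.restrict_apply hs]
      refine add_le_add (chartMeasure_le K hc' hc (hs.inter hsrc) Set.inter_subset_right) ?_
      exact (le_iSup₂ (f := fun c (_ : c ∈ atlas (Model n) M) => chartMeasure K c) c' hc') _
    refine (h B).trans (le_of_eq ?_)
    rw [Measure.add_apply, Measure.restrict_apply hB, Measure.restrict_apply hB,
      Set.inter_eq_left.2 hBc, Set.disjoint_iff_inter_eq_empty.1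
        (Set.disjoint_compl_right_iff_subset.2 hBc)]
    simp
  · exact (le_iSup₂ (f := fun c (_ : c ∈ atlas (Model n) M) => chartMeasure K c) c hc) _

theorem isFiniteMeasure_liouville [IsManifold 𝓘(ℂ, Model n) ω M] [CompactSpace M]
    (K : KahlerForm n M) : IsFiniteMeasure (liouville K) := by
  have : IsLocallyFiniteMeasure (liouville K) := by
    refine ⟨fun x => ?_⟩
    let c := chartAt (Model n) x
    have hc : c ∈ atlas (Model n) M := chart_mem_atlas _ x
    have hx : c x ∈ c.target := mem_chart_target _ x
    have hcont := (K.continuousOn_density hc).continuousAt (c.open_target.mem_nhds hx)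
    obtain ⟨r, hr, hball⟩ := Metric.mem_nhds_iff.1 (Filter.inter_mem (c.open_target.mem_nhds hx)
      (hcont.eventually (gt_mem_nhds (lt_add_one _))))
    refine ⟨c.source ∩ c ⁻¹' Metric.ball (c x) r, ?_, ?_⟩
    · exact (c.continuousOn.isOpen_inter_preimage c.open_source Metric.isOpen_ball).mem_nhds
        ⟨mem_chart_source _ x, Metric.mem_ball_self hr⟩
    · have hm := (c.continuousOn.isOpen_inter_preimage c.open_source
        (Metric.isOpen_ball (x := c x) (ε := r))).measurableSet
      rw [liouville_apply_of_subset_source K hc hm Set.inter_subset_left, chartMeasure_apply K c hm]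
      have hsub : c.target ∩ c.symm ⁻¹' (c.source ∩ c ⁻¹' Metric.ball (c x) r) ⊆
          Metric.ball (c x) r := by
        rintro y ⟨hy, -, h⟩
        simpa [c.right_inv hy] using h
      refine (lintegral_mono_set hsub).trans_lt ?_
      refine (setLIntegral_mono' Metric.isOpen_ball.measurableSet (g := fun _ => ENNReal.ofReal
        (topPower (localForm K.form c (c x)) coordVec + 1)) fun y hy =>
          ENNReal.ofReal_le_ofReal (hball hy).2.le).trans_lt ?_
      rw [setLIntegral_const]
      exact ENNReal.mul_lt_top ENNReal.ofReal_lt_top measure_ball_lt_top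
  infer_instance

theorem isOpenPosMeasure_liouville [IsManifold 𝓘(ℂ, Model n) ω M] (K : KahlerForm n M) :
    (liouville K).IsOpenPosMeasure := by
  refine ⟨fun U hU ⟨x, hx⟩ h0 => ?_⟩
  let c := chartAt (Model n) x
  have hc : c ∈ atlas (Model n) M := chart_mem_atlas _ x
  have h1 : chartMeasure K c U = 0 := le_antisymm
    (((le_iSup₂ (f := fun c (_ : c ∈ atlas (Model n) M) => chartMeasure K c) c hc) U).trans
      h0.le) zero_le
  have ho : IsOpen (c.target ∩ c.symm ⁻¹' U) := c.symm.isOpen_inter_preimage hU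
  have hne : (c.target ∩ c.symm ⁻¹' U).Nonempty :=
    ⟨c x, mem_chart_target _ x, by simpa [c] using hx⟩
  rw [chartMeasure_apply K c hU.measurableSet, setLIntegral_eq_zero_iff' ho.measurableSet
    (((K.continuousOn_density hc).mono Set.inter_subset_left).aemeasurable
      ho.measurableSet).ennreal_ofReal] at h1
  have : volume (c.target ∩ c.symm ⁻¹' U) = 0 := by
    refine measure_mono_null (fun y hy => ?_) (ae_iff.1 h1)
    exact fun h => absurd (h hy) (by simpa using K.density_pos hc hy.1)
  exact (ho.measure_pos volume hne).ne' this
end Form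

section Bundle

variable {n : ℕ} {M : Type*} [TopologicalSpace M] [ChartedSpace (Model n) M]
  {L : M → Type*} [∀ x, AddCommGroup (L x)] [∀ x, Module ℂ (L x)]
  [TopologicalSpace (TotalSpace ℂ L)] [∀ x, TopologicalSpace (L x)]
  [FiberBundle ℂ L] [VectorBundle ℂ ℂ L]

variable (n L) in
/-- `Γ_∞(M, L)`: the sections of `L` that are smooth in the real sense. -/
def smoothSections : Submodule ℂ (∀ x, L x) where
  carrier := {s | ContMDiff 𝓘(ℝ, Model n) (𝓘(ℝ, Model n).prod 𝓘(ℝ, ℂ)) ∞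
    (fun x => TotalSpace.mk' ℂ x (s x))}
  add_mem' {s t} hs ht x₀ := by
    have h1 := (contMDiffAt_section _).1 (hs x₀)
    have h2 := (contMDiffAt_section _).1 (ht x₀)
    refine (contMDiffAt_section _).2 ((h1.add h2).congr_of_eventuallyEq ?_)
    filter_upwards [(trivializationAt ℂ L x₀).open_baseSet.mem_nhds
      (mem_baseSet_trivializationAt ℂ L x₀)] with x hx
    exact ((trivializationAt ℂ L x₀).linear ℂ hx).1 _ _
  zero_mem' x₀ := by
    refine (contMDiffAt_section _).2
      ((contMDiffAt_const (c := (0 : ℂ))).congr_of_eventuallyEq ?_)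
    filter_upwards [(trivializationAt ℂ L x₀).open_baseSet.mem_nhds
      (mem_baseSet_trivializationAt ℂ L x₀)] with x hx
    exact ((trivializationAt ℂ L x₀).linear ℂ hx).map_zero
  smul_mem' a s hs x₀ := by
    have h1 := (contMDiffAt_section _).1 (hs x₀)
    refine (contMDiffAt_section _).2 (ContMDiffAt.congr_of_eventuallyEq
      (((contDiff_const (c := a)).mul contDiff_id).contMDiff.contMDiffAt.comp x₀ h1) ?_)
    filter_upwards [(trivializationAt ℂ L x₀).open_baseSet.mem_nhds
      (mem_baseSet_trivializationAt ℂ L x₀)] with x hx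
    exact ((trivializationAt ℂ L x₀).linear ℂ hx).2 _ _

theorem mul_mem_smoothSections (f : C^∞⟮𝓘(ℝ, Model n), M; 𝓘(ℝ, ℂ), ℂ⟯) {s : ∀ x, L x}
    (hs : s ∈ smoothSections n L) : (fun x => f x • s x) ∈ smoothSections n L := fun x₀ => by
  have h1 := (contMDiffAt_section _).1 (hs x₀)
  refine (contMDiffAt_section _).2 (ContMDiffAt.congr_of_eventuallyEq
    (contDiff_mul.contMDiff.contMDiffAt.comp x₀ ((f.contMDiff x₀).prodMk_space h1)) ?_)
  filter_upwards [(trivializationAt ℂ L x₀).open_baseSet.mem_nhds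
    (mem_baseSet_trivializationAt ℂ L x₀)] with x hx
  exact ((trivializationAt ℂ L x₀).linear ℂ hx).2 _ _

variable (n L) in
/-- The global holomorphic sections of `L`. -/
def holSections : Submodule ℂ (∀ x, L x) where
  carrier := {s | ContMDiff 𝓘(ℂ, Model n) (𝓘(ℂ, Model n).prod 𝓘(ℂ, ℂ)) ω
    (fun x => TotalSpace.mk' ℂ x (s x))}
  add_mem' hs ht := hs.add_section ht
  zero_mem' := contMDiff_zeroSection ℂ L
  smul_mem' _ _ hs := hs.const_smul_section

theorem holSections_le_smoothSections [IsManifold 𝓘(ℂ, Model n) ω M] :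
    holSections n L ≤ smoothSections n L := fun s hs x₀ => by
  have h1 := (contMDiffAt_section _).1 (hs x₀)
  refine (contMDiffAt_section _).2 ?_
  rw [contMDiffAt_iff] at h1 ⊢
  refine ⟨h1.1, ?_⟩
  have h2 := (h1.2.restrict_scalars ℝ).of_le (le_top : (∞ : WithTop ℕ∞) ≤ ω)
  exact h2

variable (n L) in
/-- A smooth hermitian metric on the line bundle `L`, conjugate linear in the first argument.
Smoothness is smoothness of the function `h(s_e, s_e)` for the holomorphic frames
`s_e = e.symm · 1` given by the trivializations `e` of the bundle. -/
structure HermitianMetric where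
  /-- the sesquilinear form on each fibre -/
  toForm : ∀ x, L x →ₗ⋆[ℂ] L x →ₗ[ℂ] ℂ
  conj_symm : ∀ x u v, conj (toForm x u v) = toForm x v u
  pos : ∀ x u, u ≠ 0 → 0 < (toForm x u u).re
  smooth : ∀ e ∈ trivializationAtlas ℂ L,
    ContMDiffOn 𝓘(ℝ, Model n) 𝓘(ℝ, ℝ) ∞
      (fun x => (toForm x (e.symm x 1) (e.symm x 1)).re) e.baseSet

/-- The local function `ĥ = h(s_e, s_e)` representing the metric in the holomorphic frame `s_e`. -/
def HermitianMetric.weight (h : HermitianMetric n L)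
    (e : Trivialization ℂ (TotalSpace.proj : TotalSpace ℂ L → M)) (x : M) : ℝ :=
  (h.toForm x (e.symm x 1) (e.symm x 1)).re

/-- The connection form `∂ log ĥ` of the metric connection of `(L, h)` with respect to the frame `s_e`,
in the coordinates of the chart `c`, at the point `y` and applied to `v`; here
`∂u (v) = (du(v) - i du(i v)) / 2`. -/
def HermitianMetric.connectionForm (h : HermitianMetric n L)
    (e : Trivialization ℂ (TotalSpace.proj : TotalSpace ℂ L → M))
    (c : OpenPartialHomeomorph M (Model n)) (y v : Model n) : ℂ :=
  (fderiv ℝ (fun z => Real.log (h.weight e (c.symm z))) y v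
    - Complex.I * fderiv ℝ (fun z => Real.log (h.weight e (c.symm z))) y (Complex.I • v)) / 2

/-- The covariant derivative `∇_X` of the unique connection compatible with the metric and the
complex structure, `∇ = ∂ + ∂ log ĥ + ∂̄ = d + ∂ log ĥ` in the frame `s_e`: it sends the section
`g s_e` to `(dg(X) + (∂ log ĥ)(X) g) s_e`. Everything is written in the chart `c`. -/
def HermitianMetric.covDeriv (h : HermitianMetric n L)
    (e : Trivialization ℂ (TotalSpace.proj : TotalSpace ℂ L → M))
    (c : OpenPartialHomeomorph M (Model n)) (X : Model n → Model n) (g : Model n → ℂ)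
    (y : Model n) : ℂ :=
  fderiv ℝ g y (X y) + h.connectionForm e c y (X y) * g y

/-- The quantization condition `∇_X ∇_Y - ∇_Y ∇_X - ∇_{[X,Y]} = -i ω(X, Y)` for all (local, smooth)
vector fields `X`, `Y`, applied to all (local, smooth) sections `g s_e`. -/
def IsQuantum (K : KahlerForm n M) (h : HermitianMetric n L) : Prop :=
  ∀ c ∈ atlas (Model n) M, ∀ e ∈ trivializationAtlas ℂ L,
    ∀ (X Y : Model n → Model n) (g : Model n → ℂ),
      ContDiffOn ℝ ∞ X (c.target ∩ c.symm ⁻¹' e.baseSet) →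
      ContDiffOn ℝ ∞ Y (c.target ∩ c.symm ⁻¹' e.baseSet) →
      ContDiffOn ℝ ∞ g (c.target ∩ c.symm ⁻¹' e.baseSet) →
      ∀ y ∈ c.target ∩ c.symm ⁻¹' e.baseSet,
        h.covDeriv e c X (h.covDeriv e c Y g) y - h.covDeriv e c Y (h.covDeriv e c X g) y
            - h.covDeriv e c (VectorField.lieBracket ℝ X Y) g y =
          -Complex.I * (localForm K.form c y ![X y, Y y] : ℂ) * g y

variable (L) in
/-- The fibre `L x` is a complex line: the identification with `ℂ` by the preferred trivialization. -/
def fiberEquiv (x : M) : L x ≃ₗ[ℂ] ℂ :=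
  (trivializationAt ℂ L x).linearEquivAt ℂ x (mem_baseSet_trivializationAt ℂ L x)

variable (L) in
/-- A nonzero point of the fibre over `x`. All constructions below that use it are independent of this
choice, see `coherentProjector_congr` and `epsilon_eq`. -/
def fiberPoint (x : M) : L x := (fiberEquiv L x).symm 1

/-- For a nonzero `q` in `L x`, the linear form `u ↦ u / q` on `L x`, see `coeff_smul`. -/
def coeff {x : M} (q : L x) : L x →ₗ[ℂ] ℂ := (fiberEquiv L x q)⁻¹ • (fiberEquiv L x).toLinearMap

theorem coeff_smul {x : M} {q : L x} (hq : q ≠ 0) (u : L x) : coeff q u • q = u := by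
  apply (fiberEquiv L x).injective
  have : fiberEquiv L x q ≠ 0 := by simpa using hq
  simp [coeff, field]

theorem exists_eq_smul {x : M} {q q' : L x} (hq : q ≠ 0) (hq' : q' ≠ 0) :
    ∃ a : ℂ, a ≠ 0 ∧ q' = a • q :=
  ⟨coeff q q', fun h0 => hq' (by rw [← coeff_smul hq q', h0, zero_smul]), (coeff_smul hq q').symm⟩

variable (n L) in
/-- `L` is very ample: the global holomorphic sections define an embedding of `M` into projective space.
In terms of the space `V` of global holomorphic sections the map sends `x` to the hyperplane
`{s | s x = 0}` of `V`. It has to be well defined, injective, and an immersion in the affine charts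
`{t ≠ 0}` of projective space, in which it is given by the quotients `s / t`. -/
structure IsVeryAmple : Prop where
  base_point_free : ∀ x, ∃ s ∈ holSections n L, s x ≠ 0
  injective : ∀ x y, (∀ s ∈ holSections n L, s x = 0 ↔ s y = 0) → x = y
  immersion : ∀ t ∈ holSections n L, ∀ x, t x ≠ 0 → ∀ v : TangentSpace 𝓘(ℂ, Model n) x, v ≠ 0 →
    ∃ s ∈ holSections n L,
      mfderiv 𝓘(ℂ, Model n) 𝓘(ℂ, ℂ) (fun y => coeff (t y) (s y)) x v ≠ 0

theorem HermitianMetric.continuous_pairing (h : HermitianMetric n L) {s t : ∀ x, L x}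
    (hs : s ∈ smoothSections n L) (ht : t ∈ smoothSections n L) :
    Continuous fun x => h.toForm x (s x) (t x) := by
  rw [continuous_iff_continuousAt]
  intro x₀
  set e := trivializationAt ℂ L x₀ with he
  have hx₀ : x₀ ∈ e.baseSet := mem_baseSet_trivializationAt ℂ L x₀
  have h1 := ((contMDiffAt_section _).1 (hs x₀)).continuousAt
  have h2 := ((contMDiffAt_section _).1 (ht x₀)).continuousAt
  have h3 := (h.smooth e (trivialization_mem_atlas ℂ L x₀)).continuousOn.continuousAt
    (e.open_baseSet.mem_nhds hx₀)
  refine (((Complex.continuous_conj.continuousAt.comp h1).mul h2).mul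
    (Complex.continuous_ofReal.continuousAt.comp h3)).congr ?_
  filter_upwards [e.open_baseSet.mem_nhds hx₀] with x hx
  have key : ∀ u : L x, u = (e ⟨x, u⟩).2 • e.symm x 1 := fun u => by
    have h4 := (e.symmₗ ℂ x).map_smul (e ⟨x, u⟩).2 1
    rw [Trivialization.coe_symmₗ e hx, smul_eq_mul, mul_one] at h4
    exact (e.symm_apply_apply_mk hx u).symm.trans h4
  have hreal : ((h.toForm x (e.symm x 1) (e.symm x 1)).re : ℂ) =
      h.toForm x (e.symm x 1) (e.symm x 1) :=
    Complex.conj_eq_iff_re.1 (h.conj_symm x _ _)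
  conv_rhs => rw [key (s x), key (t x)]
  simp only [LinearMap.map_smulₛₗ, LinearMap.smul_apply, RingHom.id_apply, smul_eq_mul]
  rw [← hreal]
  show conj (e ⟨x, s x⟩).2 * (e ⟨x, t x⟩).2 *
    ((h.toForm x (e.symm x 1) (e.symm x 1)).re : ℂ) = _
  ring

section L2

variable [MeasurableSpace M] [BorelSpace M] [CompactSpace M]

variable (K : KahlerForm n M) (h : HermitianMetric n L)

theorem integrable_pairing [IsManifold 𝓘(ℂ, Model n) ω M] {s t : ∀ x, L x}
    (hs : s ∈ smoothSections n L) (ht : t ∈ smoothSections n L) :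
    Integrable (fun x => h.toForm x (s x) (t x)) (liouville K) := by
  have := isFiniteMeasure_liouville K
  exact (h.continuous_pairing hs ht).integrable_of_hasCompactSupport
    (HasCompactSupport.of_compactSpace _)

/-- The scalar product `⟨s, t⟩ = ∫ h(s, t) Ω` on `Γ_∞(M, L)`. -/
abbrev sectionCore [IsManifold 𝓘(ℂ, Model n) ω M] :
    InnerProductSpace.Core ℂ (smoothSections n L) where
  inner s t := ∫ x, h.toForm x (s.1 x) (t.1 x) ∂liouville K
  conj_inner_symm s t := by
    rw [← integral_conj]
    simp only [h.conj_symm]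
  re_inner_nonneg s := by
    rw [← integral_re (integrable_pairing K h s.2 s.2)]
    refine integral_nonneg fun x => ?_
    by_cases hx : s.1 x = 0
    · simp [hx]
    · exact (h.pos x _ hx).le
  add_left r s t := by
    rw [← integral_add (integrable_pairing K h r.2 t.2) (integrable_pairing K h s.2 t.2)]
    simp
  smul_left s t c := by
    rw [← integral_const_mul]
    simp
  definite s hs := by
    have := isFiniteMeasure_liouville K
    have := isOpenPosMeasure_liouville K
    have hc := Complex.continuous_re.comp (h.continuous_pairing s.2 s.2)
    have h0 : 0 ≤ Complex.re ∘ fun x => h.toForm x (s.1 x) (s.1 x) := fun x => by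
      by_cases hx : s.1 x = 0
      · simp [hx]
      · exact (h.pos x _ hx).le
    have hre : ∫ x, (Complex.re ∘ fun x => h.toForm x (s.1 x) (s.1 x)) x ∂liouville K = 0 := by
      have := integral_re (integrable_pairing K h s.2 s.2)
      simp only [Function.comp_apply]
      refine Eq.trans this ?_
      rw [hs]; simp
    ext x
    by_contra hx
    exact (hc.integral_pos_of_hasCompactSupport_nonneg_nonzero
      (μ := liouville K) (x := x) (HasCompactSupport.of_compactSpace _) h0
      (h.pos x _ hx).ne').ne' hre

variable [IsManifold 𝓘(ℂ, Model n) ω M]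

/-- `Γ_∞(M, L)` with the scalar product `⟨s, t⟩ = ∫ h(s, t) Ω`, see `PreL2.inner_def`. -/
def PreL2 (_ : KahlerForm n M) (_ : HermitianMetric n L) : Type _ := smoothSections n L

instance : NormedAddCommGroup (PreL2 K h) :=
  @InnerProductSpace.Core.toNormedAddCommGroup ℂ (smoothSections n L) _ _ _ (sectionCore K h)

instance : InnerProductSpace ℂ (PreL2 K h) :=
  @InnerProductSpace.ofCore ℂ (smoothSections n L) _ _ _ (sectionCore K h).toCore

instance : Inner ℂ (PreL2 K h) := InnerProductSpace.toInner

variable {K h} in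
/-- The section of `L` underlying an element of `Γ_∞(M, L)`. -/
def PreL2.val (s : PreL2 K h) : ∀ x, L x := Subtype.val s

theorem PreL2.inner_def (s t : PreL2 K h) :
    inner ℂ s t = ∫ x, h.toForm x (s.val x) (t.val x) ∂liouville K := rfl

/-- The Hilbert space `L²(M, L)`, the completion of `Γ_∞(M, L)`. -/
abbrev L2Sections : Type _ := UniformSpace.Completion (PreL2 K h)

/-- `Γ_hol(M, L)` as a subspace of `Γ_∞(M, L)` (see `holSections_le_smoothSections`), with the induced
scalar product. -/
def GammaHol : Submodule ℂ (PreL2 K h) :=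
  Submodule.comap (smoothSections n L).subtype (holSections n L)

instance : Inner ℂ (GammaHol K h) := InnerProductSpace.toInner

/-- Evaluation of holomorphic sections at a point. -/
def evalAt (x : M) : GammaHol K h →ₗ[ℂ] L x where
  toFun s := s.1.val x
  map_add' _ _ := rfl
  map_smul' _ _ := rfl

/-- Multiplication of smooth sections by a smooth complex-valued function. -/
def mulSection (f : C^∞⟮𝓘(ℝ, Model n), M; 𝓘(ℝ, ℂ), ℂ⟯) : PreL2 K h →ₗ[ℂ] PreL2 K h where
  toFun s := (⟨fun x => f x • s.val x, mul_mem_smoothSections f s.2⟩ : smoothSections n L)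
  map_add' s t := Subtype.ext (funext fun x => smul_add (f x) (s.val x) (t.val x))
  map_smul' a s := Subtype.ext (funext fun x => smul_comm (f x) a (s.val x))

/-- The isometric inclusion of `Γ_hol(M, L)` in `L²(M, L)`. -/
def holEmbedding : GammaHol K h →ₗᵢ[ℂ] L2Sections K h :=
  UniformSpace.Completion.toComplₗᵢ.comp (GammaHol K h).subtypeₗᵢ

section FiniteDim

variable [FiniteDimensional ℂ (GammaHol K h)]

/-- The orthogonal projection `Π : L²(M, L) → Γ_hol(M, L)`. -/
def holProjection : L2Sections K h →L[ℂ] GammaHol K h :=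
  ((holEmbedding K h).equivRange.symm : _ →L[ℂ] GammaHol K h) ∘L
    (LinearMap.range (holEmbedding K h).toLinearMap).orthogonalProjectionOnto

/-- The Toeplitz operator `T_f s = Π (f s)` on `Γ_hol(M, L)`. -/
def toeplitz (f : C^∞⟮𝓘(ℝ, Model n), M; 𝓘(ℝ, ℂ), ℂ⟯) : GammaHol K h →ₗ[ℂ] GammaHol K h :=
  (holProjection K h).toLinearMap ∘ₗ UniformSpace.Completion.toComplₗᵢ.toLinearMap ∘ₗ
    mulSection K h f ∘ₗ (GammaHol K h).subtype

/-- The coherent vector `e_q`: the holomorphic section with `⟨e_q, s⟩ = s(x) / q` for all holomorphic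
sections `s`, where `q ≠ 0` lies over `x`. -/
def coherentVector {x : M} (q : L x) : GammaHol K h :=
  haveI : CompleteSpace (GammaHol K h) := FiniteDimensional.complete ℂ _
  (InnerProductSpace.toDual ℂ (GammaHol K h)).symm
    (LinearMap.toContinuousLinearMap (coeff q ∘ₗ evalAt K h x))

theorem inner_coherentVector {x : M} (q : L x) (s : GammaHol K h) :
    inner ℂ (coherentVector K h q) s = coeff q (s.1.val x) := by
  simp only [coherentVector, InnerProductSpace.toDual_symm_apply]
  rfl

/-- The coherent projector `|e_q⟩⟨e_q| / ⟨e_q, e_q⟩`. -/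
def coherentProjector {x : M} (q : L x) : GammaHol K h →ₗ[ℂ] GammaHol K h :=
  (inner ℂ (coherentVector K h q) (coherentVector K h q))⁻¹ •
    (innerₛₗ ℂ (coherentVector K h q)).smulRight (coherentVector K h q)

/-- The covariant Berezin symbol `σ(A)(x) = Tr (A P_x)`. -/
def covariantSymbol (A : GammaHol K h →ₗ[ℂ] GammaHol K h) (x : M) : ℂ :=
  LinearMap.trace ℂ _ (A ∘ₗ coherentProjector K h (fiberPoint L x))

/-- The epsilon function `ε(x) = h(q, q) ⟨e_q, e_q⟩`, `q ≠ 0` over `x`. -/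
def epsilon (x : M) : ℝ :=
  (h.toForm x (fiberPoint L x) (fiberPoint L x)).re *
    ‖coherentVector K h (fiberPoint L x)‖ ^ 2

theorem coherentVector_smul {x : M} (a : ℂ) (q : L x) :
    coherentVector K h (a • q) = (conj a)⁻¹ • coherentVector K h q := by
  refine ext_inner_right ℂ fun s => ?_
  rw [inner_smul_left, inner_coherentVector, inner_coherentVector]
  simp [coeff]
  ring

theorem coherentProjector_congr {x : M} {q q' : L x} (hq : q ≠ 0) (hq' : q' ≠ 0) :
    coherentProjector K h q' = coherentProjector K h q := by
  obtain ⟨a, ha, rfl⟩ := exists_eq_smul hq hq'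
  have ha' : conj a ≠ 0 := by simpa using ha
  ext1 s
  simp only [coherentProjector, coherentVector_smul, LinearMap.smul_apply,
    LinearMap.smulRight_apply, innerₛₗ_apply_apply, inner_smul_left, inner_smul_right, smul_smul]
  congr 1
  simp only [map_inv₀, Complex.conj_conj]
  field_simp

theorem epsilon_eq {x : M} {q : L x} (hq : q ≠ 0) :
    epsilon K h x = (h.toForm x q q).re * ‖coherentVector K h q‖ ^ 2 := by
  have h0 : fiberPoint L x ≠ 0 := by simp [fiberPoint]
  obtain ⟨a, ha, h1⟩ := exists_eq_smul hq h0
  have ha' : ‖a‖ ≠ 0 := by simpa using ha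
  have h2 : h.toForm x (a • q) (a • q) = ((‖a‖ ^ 2 : ℝ) : ℂ) * h.toForm x q q := by
    simp only [LinearMap.map_smulₛₗ, LinearMap.smul_apply, RingHom.id_apply, smul_eq_mul]
    push_cast
    rw [← Complex.conj_mul']
    ring
  rw [epsilon, h1, coherentVector_smul, h2, Complex.re_ofReal_mul, norm_smul, norm_inv,
    Complex.norm_conj]
  field_simp

/-- The modified measure `Ω_ε = ε Ω`. -/
def liouvilleEps : Measure M :=
  (liouville K).withDensity fun x => ENNReal.ofReal (epsilon K h x)

/-- The scalar product `⟨u, v⟩_ε = ∫ ū v Ω_ε` of functions on `M`. -/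
def epsInner (u v : M → ℂ) : ℂ :=
  ∫ x, conj (u x) * v x ∂liouvilleEps K h

/-- The Hilbert–Schmidt scalar product `Tr (A* C)`. -/
def hsInner (A C : GammaHol K h →ₗ[ℂ] GammaHol K h) : ℂ :=
  LinearMap.trace ℂ _ (LinearMap.adjoint A ∘ₗ C)

end FiniteDim

end L2
end Bundle
end BerezinToeplitz

end

open BerezinToeplitz Bundle MeasureTheory

open scoped Manifold ContDiff Bundle ComplexConjugate
noncomputable section
namespace BerezinToeplitz
open MeasureTheory Bundle

section Bundle

variable {n : ℕ} {M : Type*} [TopologicalSpace M] [ChartedSpace (Model n) M]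
  {L : M → Type*} [∀ x, AddCommGroup (L x)] [∀ x, Module ℂ (L x)]
  [TopologicalSpace (TotalSpace ℂ L)] [∀ x, TopologicalSpace (L x)]
  [FiberBundle ℂ L] [VectorBundle ℂ ℂ L]

/-! Adjointness is a pointwise identity integrated over $M$. For an orthonormal basis $b_k$ of
$\Gamma_{hol}$, expanding $e_q$ in this basis gives $h(q,q)\langle e_q,Ae_q\rangle=\sum_k
h(b_k,Ab_k)(x)$ for every endomorphism $A$ (`toForm_mul_inner_coherentVector`). The left side is
$\epsilon(x)\,\sigma(A)(x)$, because $\mathrm{Tr}(AP_x)=\langle e_q,Ae_q\rangle/\langle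
e_q,e_q\rangle$ (`epsilon_mul_covariantSymbol`). On the other side, $\Pi$ drops out of the matrix
elements of $T_f$, so that $\mathrm{Tr}(A^*T_f)=\sum_k\langle Ab_k,fb_k\rangle=\int\sum_k
h(Ab_k,b_k)\,f\,\Omega=\int\overline{\epsilon\,\sigma(A)}\,f\,\Omega$ (`inner_toeplitz`,
`hsInner_toeplitz`). Since $\epsilon$ is real, this is $\langle\sigma(A),f\rangle_\epsilon$.

The same sums, with $A=\mathrm{id}$ for $\epsilon$ itself, exhibit $\epsilon$ and
$\epsilon\,\sigma(A)$ as finite sums of smooth pairings. Positivity of $\epsilon$ follows from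
base-point-freeness, and then $\sigma(A)$ is smooth as a quotient.

Finite-dimensionality of $\Gamma_{hol}$ rests on the Schwarz lemma and compactness. A section
vanishing at $x_0$ has, near $x_0$, a norm squared of at most half its global maximum, on a
neighbourhood that does not depend on the section (`HermitianMetric.exists_nhds_forall_toForm_le`).
Finitely many such neighbourhoods cover $M$, so a section vanishing at all their centres is zero. -/

/-! ### The hermitian metric in local frames. -/

theorem HermitianMetric.toForm_self_ofReal (h : HermitianMetric n L) (x : M) (u : L x) :
    ((h.toForm x u u).re : ℂ) = h.toForm x u u :=
  Complex.conj_eq_iff_re.1 (h.conj_symm x u u)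

theorem HermitianMetric.toForm_self_nonneg (h : HermitianMetric n L) (x : M) (u : L x) :
    0 ≤ (h.toForm x u u).re := by
  by_cases hu : u = 0
  · simp [hu]
  · exact (h.pos x u hu).le

theorem symm_smul_trivialization {e : Trivialization ℂ (TotalSpace.proj : TotalSpace ℂ L → M)}
    [MemTrivializationAtlas e] {x : M} (hx : x ∈ e.baseSet) (u : L x) :
    (e ⟨x, u⟩).2 • e.symm x 1 = u := by
  have h4 := (e.symmₗ ℂ x).map_smul (e ⟨x, u⟩).2 1
  rw [Trivialization.coe_symmₗ e hx, smul_eq_mul, mul_one] at h4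
  exact h4.symm.trans (e.symm_apply_apply_mk hx u)

theorem HermitianMetric.toForm_eq_weight (h : HermitianMetric n L)
    {e : Trivialization ℂ (TotalSpace.proj : TotalSpace ℂ L → M)} [MemTrivializationAtlas e]
    {x : M} (hx : x ∈ e.baseSet) (u v : L x) :
    h.toForm x u v = conj (e ⟨x, u⟩).2 * (e ⟨x, v⟩).2 * (h.weight e x : ℂ) := by
  conv_lhs => rw [← symm_smul_trivialization hx u, ← symm_smul_trivialization hx v]
  simp only [LinearMap.map_smulₛₗ, LinearMap.smul_apply, RingHom.id_apply, smul_eq_mul,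
    HermitianMetric.weight, h.toForm_self_ofReal]
  ring

theorem fiberPoint_ne_zero (x : M) : fiberPoint L x ≠ 0 := by simp [fiberPoint]

/-- Counterpart of `HermitianMetric.toForm_eq_weight` with an arbitrary nonzero fibre vector as
frame. It matches $h$ with coherent vectors, whose inner products are values of `coeff q`. -/
theorem HermitianMetric.toForm_eq_coeff (h : HermitianMetric n L) {x : M} {q : L x} (hq : q ≠ 0)
    (u v : L x) :
    h.toForm x u v = conj (coeff q u) * coeff q v * ((h.toForm x q q).re : ℂ) := by
  conv_lhs => rw [← coeff_smul hq u, ← coeff_smul hq v]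
  simp only [LinearMap.map_smulₛₗ, LinearMap.smul_apply, RingHom.id_apply, smul_eq_mul,
    h.toForm_self_ofReal]
  ring

theorem HermitianMetric.weight_pos (h : HermitianMetric n L)
    {e : Trivialization ℂ (TotalSpace.proj : TotalSpace ℂ L → M)} [MemTrivializationAtlas e]
    {x : M} (hx : x ∈ e.baseSet) : 0 < h.weight e x := by
  refine h.pos x _ fun h0 => ?_
  have h1 := e.apply_mk_symm hx (1 : ℂ)
  rw [h0] at h1
  have h2 := ((e.linear ℂ hx).map_zero).symm.trans (congrArg Prod.snd h1)
  exact zero_ne_one h2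

/-- The metric is assumed smooth only on the frames $s_e$. Near each point the pairing is a product
of section coordinates, one of them conjugated, with the weight. -/
theorem HermitianMetric.contMDiff_pairing (h : HermitianMetric n L) {s t : ∀ x, L x}
    (hs : s ∈ smoothSections n L) (ht : t ∈ smoothSections n L) :
    ContMDiff 𝓘(ℝ, Model n) 𝓘(ℝ, ℂ) ∞ fun x => h.toForm x (s x) (t x) := by
  intro x₀
  set e := trivializationAt ℂ L x₀
  have hx₀ : x₀ ∈ e.baseSet := mem_baseSet_trivializationAt ℂ L x₀
  have h1 := (contMDiffAt_section _).1 (hs x₀)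
  have h2 := (contMDiffAt_section _).1 (ht x₀)
  have h3 := (h.smooth e (trivialization_mem_atlas ℂ L x₀)).contMDiffAt
    (e.open_baseSet.mem_nhds hx₀)
  have h1' := Complex.conjCLE.contDiff.contMDiff.contMDiffAt.comp x₀ h1
  have h3' := Complex.ofRealCLM.contDiff.contMDiff.contMDiffAt.comp x₀ h3
  have h12 := (contDiff_mul (𝕜 := ℝ) (𝔸 := ℂ)).contMDiff.contMDiffAt.comp x₀ (h1'.prodMk_space h2)
  have h123 := (contDiff_mul (𝕜 := ℝ) (𝔸 := ℂ)).contMDiff.contMDiffAt.comp x₀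
    (h12.prodMk_space h3')
  refine h123.congr_of_eventuallyEq ?_
  filter_upwards [e.open_baseSet.mem_nhds hx₀] with x hx
  exact h.toForm_eq_weight hx _ _

/-! ### Finite-dimensionality of the space of holomorphic sections. -/

/-- A holomorphic section that vanishes at `x₀` is, near `x₀`, much smaller than its maximum,
uniformly in the section. -/
theorem HermitianMetric.exists_nhds_forall_toForm_le [IsManifold 𝓘(ℂ, Model n) ω M]
    [ContMDiffVectorBundle ω ℂ L 𝓘(ℂ, Model n)] (h : HermitianMetric n L) (x₀ : M) :
    ∃ U ∈ nhds x₀, ∀ s ∈ holSections n L, s x₀ = 0 → ∀ C : ℝ, 0 ≤ C →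
      (∀ x, (h.toForm x (s x) (s x)).re ≤ C) → ∀ x ∈ U, (h.toForm x (s x) (s x)).re ≤ C / 2 := by
  set e := trivializationAt ℂ L x₀ with he
  set c := chartAt (Model n) x₀ with hc
  have hx₀ : x₀ ∈ e.baseSet := mem_baseSet_trivializationAt ℂ L x₀
  have hw : ContinuousAt (h.weight e) x₀ :=
    (h.smooth e (trivialization_mem_atlas ℂ L x₀)).continuousOn.continuousAt
      (e.open_baseSet.mem_nhds hx₀)
  have hw0 := h.weight_pos hx₀
  -- Keeping the weight within a factor 2 of its value at $x_0$ makes the bounds on $h(s,s)$ and on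
  -- the coordinate $|f|^2$ comparable, with a total loss of 4.
  have hV : {x | x ∈ e.baseSet ∧ h.weight e x₀ / 2 < h.weight e x ∧
      h.weight e x < 2 * h.weight e x₀} ∈ nhds x₀ := by
    filter_upwards [e.open_baseSet.mem_nhds hx₀, hw.eventually (lt_mem_nhds (half_lt_self hw0)),
      hw.eventually (gt_mem_nhds (show h.weight e x₀ < 2 * h.weight e x₀ by linarith))]
      with x h1 h2 h3 using ⟨h1, h2, h3⟩
  have hct : c x₀ ∈ c.target := mem_chart_target _ x₀
  have hcx : c.symm (c x₀) = x₀ := c.left_inv (mem_chart_source _ x₀)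
  have hV' := (c.continuousAt_symm hct).preimage_mem_nhds (by rwa [hcx])
  obtain ⟨R, hR, hball⟩ := Metric.mem_nhds_iff.1 (Filter.inter_mem (c.open_target.mem_nhds hct) hV')
  -- On the quarter ball the Schwarz lemma gains $1/4$ in $|f|$, hence $1/16$ in $|f|^2$. This
  -- outweighs the factor 4 lost to the weight and leaves $C/4$.
  have hU : ∀ᶠ x in nhds x₀, x ∈ c.source ∧ c x ∈ Metric.ball (c x₀) (R / 4) :=
    Filter.inter_mem (c.open_source.mem_nhds (mem_chart_source _ x₀))
      ((c.continuousAt (mem_chart_source _ x₀)).preimage_mem_nhds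
        (Metric.ball_mem_nhds _ (by positivity)))
  refine ⟨_, hU, fun s hs hs0 C hC hsC x hx => ?_⟩
  set f : Model n → ℂ := fun y => (e ⟨c.symm y, s (c.symm y)⟩).2 with hf
  have hfn : ∀ x ∈ e.baseSet, (h.toForm x (s x) (s x)).re =
      ‖(e ⟨x, s x⟩).2‖ ^ 2 * h.weight e x := fun x hx => by
    rw [h.toForm_eq_weight hx, Complex.conj_mul']
    norm_cast
  have hd : DifferentiableOn ℂ f (Metric.ball (c x₀) R) := by
    intro y hy
    obtain ⟨hyt, hyb, -⟩ := hball hy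
    have h1 := (e.contMDiffAt_section_iff hyb).1 (hs (c.symm y))
    have h2 := (contMDiffOn_chart_symm (I := 𝓘(ℂ, Model n)) (n := ω) (x := x₀)).contMDiffAt
      (c.open_target.mem_nhds hyt)
    exact ((h1.comp y h2).contDiffAt.differentiableAt (by simp)).differentiableWithinAt
  have hf0 : f (c x₀) = 0 := by
    simp only [hf]
    rw [hcx, hs0]
    exact (e.linear ℂ hx₀).map_zero
  -- The weight exceeds half its value at $x_0$ on the ball, so $|f|^2\cdot\hat h\le C$ gives
  -- $|f|\le B$ there.
  set B := Real.sqrt (2 * C / h.weight e x₀) with hB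
  have hB2 : B ^ 2 = 2 * C / h.weight e x₀ := Real.sq_sqrt (by positivity)
  have hmaps : Set.MapsTo f (Metric.ball (c x₀) R) (Metric.closedBall (f (c x₀)) B) := by
    intro y hy
    obtain ⟨hyt, hyb, hy1, hy2⟩ := hball hy
    rw [hf0, mem_closedBall_zero_iff]
    refine Real.le_sqrt_of_sq_le ?_
    have h1 := hsC (c.symm y)
    rw [hfn _ hyb] at h1
    rw [le_div_iff₀ hw0]
    nlinarith [sq_nonneg ‖f y‖]
  obtain ⟨hxs, hxb⟩ := hx
  have hxR : c x ∈ Metric.ball (c x₀) R := Metric.ball_subset_ball (by linarith) hxb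
  -- Schwarz lemma on the ball of radius $R$, for the holomorphic function $f$ vanishing at the
  -- centre and bounded by $B$.
  have key := Complex.dist_le_div_mul_dist_of_mapsTo_ball hd hmaps hxR
  obtain ⟨hyt, hyb, hy1, hy2⟩ := hball hxR
  rw [c.left_inv hxs] at hyb hy1 hy2
  have hfx : f (c x) = (e ⟨x, s x⟩).2 := by simp only [hf]; rw [c.left_inv hxs]
  rw [hf0, dist_zero_right, hfx] at key
  have key' : ‖(e ⟨x, s x⟩).2‖ ≤ B / 4 := by
    refine key.trans ?_
    rw [Metric.mem_ball] at hxb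
    rw [div_mul_eq_mul_div, div_le_iff₀ hR]
    have : 0 ≤ B := Real.sqrt_nonneg _
    nlinarith
  have key2 : ‖(e ⟨x, s x⟩).2‖ ^ 2 ≤ 2 * C / h.weight e x₀ / 16 := by
    rw [← hB2]
    nlinarith [norm_nonneg (e ⟨x, s x⟩).2]
  rw [hfn x hyb]
  have hwx : 0 ≤ h.weight e x := (h.weight_pos hyb).le
  calc _ ≤ 2 * C / h.weight e x₀ / 16 * (2 * h.weight e x₀) := by gcongr
    _ = C / 4 := by field_simp; ring
    _ ≤ C / 2 := by linarith

/-- Evaluation at the finitely many centres of a subcover is injective. If $s$ vanishes at all of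
them, a maximum point of $h(s,s)$ lies in one of the neighbourhoods, where $h(s,s)$ is at most half
its maximum; so the maximum is zero. -/
theorem finiteDimensional_holSections [IsManifold 𝓘(ℂ, Model n) ω M] [CompactSpace M]
    [ContMDiffVectorBundle ω ℂ L 𝓘(ℂ, Model n)]
    (h : HermitianMetric n L) : FiniteDimensional ℂ (holSections n L) := by
  choose U hU hUs using h.exists_nhds_forall_toForm_le
  obtain ⟨t, -, ht⟩ := isCompact_univ.elim_nhds_subcover U fun x _ => hU x
  let E : holSections n L →ₗ[ℂ] (t → ℂ) :=
    LinearMap.pi fun x => (fiberEquiv L x.1).toLinearMap ∘ₗ LinearMap.proj x.1 ∘ₗ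
      (holSections n L).subtype
  refine FiniteDimensional.of_injective E ((injective_iff_map_eq_zero E).2 fun s hs => ?_)
  have hs0 : ∀ x ∈ t, s.1 x = 0 := fun x hx => by
    have := congrFun hs ⟨x, hx⟩
    simpa [E] using this
  have hcont : Continuous fun x => (h.toForm x (s.1 x) (s.1 x)).re :=
    Complex.continuous_re.comp (h.continuous_pairing (holSections_le_smoothSections s.2)
      (holSections_le_smoothSections s.2))
  ext x
  have : Nonempty M := ⟨x⟩
  obtain ⟨m, -, hm⟩ := isCompact_univ.exists_isMaxOn Set.univ_nonempty hcont.continuousOn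
  have hm' : ∀ y, (h.toForm y (s.1 y) (s.1 y)).re ≤ (h.toForm m (s.1 m) (s.1 m)).re :=
    fun y => hm (Set.mem_univ y)
  obtain ⟨z, hz⟩ := Set.mem_iUnion.1 (ht (Set.mem_univ m))
  obtain ⟨hzt, hz⟩ := Set.mem_iUnion.1 hz
  -- The bound $C$ is the maximum itself, attained at $m$, which gives $C\le C/2$.
  have h1 := hUs z s.1 s.2 (hs0 z hzt) _ (h.toForm_self_nonneg m _) hm' m hz
  by_contra hx
  have h2 := h.pos x _ hx
  have h3 := hm' x
  linarith

section L2

variable [MeasurableSpace M] [BorelSpace M] [CompactSpace M]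
variable (K : KahlerForm n M) (h : HermitianMetric n L)
variable [IsManifold 𝓘(ℂ, Model n) ω M]

theorem finiteDimensional_gammaHol [ContMDiffVectorBundle ω ℂ L 𝓘(ℂ, Model n)] :
    FiniteDimensional ℂ (GammaHol K h) := by
  have := finiteDimensional_holSections h
  let E : GammaHol K h →ₗ[ℂ] holSections n L :=
    { toFun := fun s => ⟨s.1.val, s.2⟩
      map_add' := fun _ _ => rfl
      map_smul' := fun _ _ => rfl }
  refine FiniteDimensional.of_injective E fun s t hst => ?_
  exact Subtype.ext (Subtype.ext (congrArg (fun r : holSections n L => r.1) hst))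

variable {K h} in
theorem PreL2.val_mem (s : PreL2 K h) : s.val ∈ smoothSections n L := Subtype.property s

/-! ### Matrix elements of Toeplitz operators. -/

section FiniteDim

variable [FiniteDimensional ℂ (GammaHol K h)]

/-- The projection onto a subspace is adjoint to its inclusion. This is what removes $\Pi$ from the
matrix elements of $T_f$. -/
theorem inner_holProjection (s : GammaHol K h) (v : L2Sections K h) :
    inner ℂ s (holProjection K h v) = inner ℂ (holEmbedding K h s) v := by
  have h1 : holEmbedding K h (holProjection K h v) =
      ((LinearMap.range (holEmbedding K h).toLinearMap).orthogonalProjectionOnto v :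
        L2Sections K h) :=
    congrArg Subtype.val ((holEmbedding K h).equivRange.apply_symm_apply _)
  rw [← (holEmbedding K h).inner_map_map, h1]
  exact Submodule.inner_orthogonalProjectionOnto_eq_of_mem_left
    (⟨holEmbedding K h s, s, rfl⟩ : LinearMap.range (holEmbedding K h).toLinearMap) v

theorem inner_toeplitz (f : C^∞⟮𝓘(ℝ, Model n), M; 𝓘(ℝ, ℂ), ℂ⟯) (s t : GammaHol K h) :
    inner ℂ s (toeplitz K h f t) =
      ∫ x, h.toForm x (s.1.val x) (t.1.val x) * f x ∂liouville K := by
  have h1 : inner ℂ s (toeplitz K h f t) = inner ℂ s.1 (mulSection K h f t.1) :=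
    (inner_holProjection K h s _).trans (UniformSpace.Completion.inner_coe _ _)
  rw [h1, PreL2.inner_def]
  refine integral_congr_ae (Filter.Eventually.of_forall fun x => ?_)
  show h.toForm x (s.1.val x) (f x • t.1.val x) = _
  rw [map_smul, smul_eq_mul, mul_comm]

/-! ### The epsilon function and the covariant symbol through an orthonormal basis. -/

variable {ι : Type*} [Fintype ι] (b : OrthonormalBasis ι ℂ (GammaHol K h))

/-- With $e_q=\sum_k\langle b_k,e_q\rangle b_k$, the term of index $k$ is $\overline{b_k(x)/q}\cdot
(Ab_k)(x)/q$, and the factor $h(q,q)$ turns it into $h(b_k,Ab_k)(x)$. The choice of $q$ thereby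
cancels. -/
theorem toForm_mul_inner_coherentVector (A : GammaHol K h →ₗ[ℂ] GammaHol K h) {x : M} {q : L x}
    (hq : q ≠ 0) :
    ((h.toForm x q q).re : ℂ) * inner ℂ (coherentVector K h q) (A (coherentVector K h q)) =
      ∑ k, h.toForm x ((b k).1.val x) ((A (b k)).1.val x) := by
  conv_lhs => rw [← b.sum_repr' (coherentVector K h q)]
  simp only [map_sum, map_smul, inner_sum, inner_smul_right]
  -- Only the vector inside $A$ has to stay expanded; the left argument of the inner product is
  -- folded back to $e_q$.
  rw [b.sum_repr', Finset.mul_sum]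
  refine Finset.sum_congr rfl fun k _ => ?_
  rw [h.toForm_eq_coeff hq ((b k).1.val x), ← inner_conj_symm, inner_coherentVector, inner_coherentVector]
  ring

/-- The composite has rank at most one, being a multiple of $|Ae_q\rangle\langle e_q|$, whose trace
is $\langle e_q,Ae_q\rangle$. -/
theorem trace_comp_coherentProjector (A : GammaHol K h →ₗ[ℂ] GammaHol K h) {x : M} (q : L x) :
    LinearMap.trace ℂ _ (A ∘ₗ coherentProjector K h q) =
      (inner ℂ (coherentVector K h q) (coherentVector K h q))⁻¹ *
        inner ℂ (coherentVector K h q) (A (coherentVector K h q)) := by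
  have h1 : A ∘ₗ coherentProjector K h q =
      (inner ℂ (coherentVector K h q) (coherentVector K h q))⁻¹ •
        (innerₛₗ ℂ (coherentVector K h q)).smulRight (A (coherentVector K h q)) := by
    ext1 s
    simp [coherentProjector]
  rw [h1, map_smul, LinearMap.trace_smulRight, smul_eq_mul]
  rfl

theorem epsilon_eq_sum (x : M) :
    (epsilon K h x : ℂ) = ∑ k, h.toForm x ((b k).1.val x) ((b k).1.val x) := by
  have := toForm_mul_inner_coherentVector K h b LinearMap.id (fiberPoint_ne_zero (L := L) x)
  rw [LinearMap.id_apply, inner_self_eq_norm_sq_to_K] at this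
  refine Eq.trans ?_ this
  simp [epsilon]

/-- Multiplying by $\epsilon$ cancels the normalization $\langle e_q,e_q\rangle$ of $P_x$. What
remains is a sum of pairings of sections, which is smooth in $x$ and can be integrated term by term.
-/
theorem epsilon_mul_covariantSymbol (A : GammaHol K h →ₗ[ℂ] GammaHol K h) (x : M) :
    (epsilon K h x : ℂ) * covariantSymbol K h A x =
      ∑ k, h.toForm x ((b k).1.val x) ((A (b k)).1.val x) := by
  rw [← toForm_mul_inner_coherentVector K h b A (fiberPoint_ne_zero (L := L) x), covariantSymbol,
    trace_comp_coherentProjector, inner_self_eq_norm_sq_to_K]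
  -- If $e_q=0$, the factor $\epsilon(x)$ and the inner product on the other side both vanish, so
  -- the value given to $0^{-1}$ is immaterial.
  by_cases h0 : coherentVector K h (fiberPoint L x) = 0
  · simp [h0]
  · have : ((‖coherentVector K h (fiberPoint L x)‖ : ℝ) : ℂ) ≠ 0 := by simpa using h0
    simp only [epsilon, Complex.coe_algebraMap]
    push_cast
    field_simp

/-- Since $s(x)=\langle e_q,s\rangle q$, the vanishing of $e_q$ would force every holomorphic
section to vanish at $x$. -/
theorem epsilon_pos {x : M} (hx : ∃ s ∈ holSections n L, s x ≠ 0) : 0 < epsilon K h x := by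
  obtain ⟨s, hs, hsx⟩ := hx
  refine mul_pos (h.pos x _ (fiberPoint_ne_zero x)) (pow_pos (norm_pos_iff.2 fun h0 => hsx ?_) 2)
  let s' : GammaHol K h := ⟨(⟨s, holSections_le_smoothSections hs⟩ : smoothSections n L), hs⟩
  have h1 := inner_coherentVector K h (fiberPoint L x) s'
  rw [h0, inner_zero_left] at h1
  rw [← coeff_smul (fiberPoint_ne_zero x) (s x)]
  exact (congrArg (· • fiberPoint L x) h1.symm).trans (zero_smul _ _)

/-! ### Smoothness of the epsilon function and of symbols. -/

theorem contMDiff_epsilon :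
    ContMDiff 𝓘(ℝ, Model n) 𝓘(ℝ, ℂ) ∞ fun x => (epsilon K h x : ℂ) := by
  simp only [epsilon_eq_sum K h (stdOrthonormalBasis ℂ (GammaHol K h))]
  exact contMDiff_finsetSum fun k _ => h.contMDiff_pairing (PreL2.val_mem _) (PreL2.val_mem _)

theorem continuous_epsilon : Continuous (epsilon K h) :=
  Complex.continuous_re.comp (contMDiff_epsilon K h).continuous

/-- The symbol is defined through fibre points chosen separately at each $x$, so smoothness is read
off from the choice-free quotient $\sum_k h(b_k,Ab_k)/\epsilon$. -/
theorem contMDiff_covariantSymbol (hpos : ∀ x, 0 < epsilon K h x)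
    (A : GammaHol K h →ₗ[ℂ] GammaHol K h) :
    ContMDiff 𝓘(ℝ, Model n) 𝓘(ℝ, ℂ) ∞ (covariantSymbol K h A) := by
  set b := stdOrthonormalBasis ℂ (GammaHol K h)
  have hne : ∀ x, (epsilon K h x : ℂ) ≠ 0 := fun x => by exact_mod_cast (hpos x).ne'
  have hnum : ContMDiff 𝓘(ℝ, Model n) 𝓘(ℝ, ℂ) ∞
      fun x => ∑ k, h.toForm x ((b k).1.val x) ((A (b k)).1.val x) :=
    contMDiff_finsetSum fun k _ => h.contMDiff_pairing (PreL2.val_mem _) (PreL2.val_mem _)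
  have heq : covariantSymbol K h A = fun x =>
      (∑ k, h.toForm x ((b k).1.val x) ((A (b k)).1.val x)) / (epsilon K h x : ℂ) := by
    ext x
    rw [eq_div_iff (hne x), mul_comm, epsilon_mul_covariantSymbol K h b]
  rw [heq]
  intro x
  have hdiv : ContDiffAt ℝ ∞ (fun p : ℂ × ℂ => p.1 / p.2)
      (∑ k, h.toForm x ((b k).1.val x) ((A (b k)).1.val x), (epsilon K h x : ℂ)) := by
    simp only [div_eq_mul_inv]
    exact contDiffAt_fst.mul (contDiffAt_snd.inv (hne x))
  exact hdiv.contMDiffAt.comp x ((hnum x).prodMk_space (contMDiff_epsilon K h x))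

/-! ### Integration against $\Omega_\epsilon$ and adjointness. -/

theorem integrable_liouvilleEps {u : M → ℂ} (hu : Continuous u) :
    Integrable u (liouvilleEps K h) := by
  have := isFiniteMeasure_liouville K
  have hc := continuous_epsilon K h
  refine (integrable_withDensity_iff_integrable_coe_smul
    (f := fun x => (epsilon K h x).toNNReal) hc.measurable.real_toNNReal).2 ?_
  refine Continuous.integrable_of_hasCompactSupport ?_ (HasCompactSupport.of_compactSpace _)
  fun_prop

theorem integral_liouvilleEps (hpos : ∀ x, 0 < epsilon K h x) (u : M → ℂ) :
    ∫ x, u x ∂liouvilleEps K h = ∫ x, (epsilon K h x : ℂ) * u x ∂liouville K := by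
  refine (integral_withDensity_eq_integral_smul
    (f := fun x => (epsilon K h x).toNNReal)
    (continuous_epsilon K h).measurable.real_toNNReal u).trans ?_
  refine integral_congr_ae (Filter.Eventually.of_forall fun x => ?_)
  -- The density of $\Omega_\epsilon$ is $\epsilon$ truncated below at zero; positivity makes the
  -- truncation harmless.
  simp only [NNReal.smul_def, Real.coe_toNNReal _ (hpos x).le, Complex.real_smul]

/-- In an orthonormal basis the trace is $\sum_k\langle Ab_k,T_fb_k\rangle=\sum_k\int
h(Ab_k,b_k)f\,\Omega$. After exchanging the sum and the integral, the two integrands agree at every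
point. -/
theorem hsInner_toeplitz (hpos : ∀ x, 0 < epsilon K h x) (A : GammaHol K h →ₗ[ℂ] GammaHol K h)
    (f : C^∞⟮𝓘(ℝ, Model n), M; 𝓘(ℝ, ℂ), ℂ⟯) :
    hsInner K h A (toeplitz K h f) = epsInner K h (covariantSymbol K h A) f := by
  have := isFiniteMeasure_liouville K
  set b := stdOrthonormalBasis ℂ (GammaHol K h)
  rw [hsInner, epsInner, integral_liouvilleEps K h hpos, LinearMap.trace_eq_sum_inner _ b]
  simp only [LinearMap.comp_apply, LinearMap.adjoint_inner_right, inner_toeplitz]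
  rw [← integral_finsetSum]
  · refine integral_congr_ae (Filter.Eventually.of_forall fun x => ?_)
    -- Conjugation exchanges the arguments of $h$ and fixes the real number $\epsilon(x)$, giving
    -- $\epsilon\,\overline{\sigma(A)}=\sum_k h(Ab_k,b_k)$.
    have h1 := congrArg conj (epsilon_mul_covariantSymbol K h b A x)
    rw [map_mul, Complex.conj_ofReal, map_sum] at h1
    simp only [h.conj_symm] at h1
    show _ = _ * (_ * f x)
    rw [← mul_assoc, h1, Finset.sum_mul]
  · intro k _
    refine Continuous.integrable_of_hasCompactSupport ?_ (HasCompactSupport.of_compactSpace _)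
    exact (h.continuous_pairing (PreL2.val_mem _) (PreL2.val_mem _)).mul f.contMDiff.continuous

end FiniteDim

end L2
end Bundle
end BerezinToeplitz

end

open BerezinToeplitz Bundle MeasureTheory
theorem theorem3p2 {n : ℕ} {M : Type*} [TopologicalSpace M] [T2Space M] [CompactSpace M]
    [ChartedSpace (Model n) M] [IsManifold 𝓘(ℂ, Model n) ω M]
    [MeasurableSpace M] [BorelSpace M]
    {L : M → Type*} [∀ x, AddCommGroup (L x)] [∀ x, Module ℂ (L x)]
    [TopologicalSpace (TotalSpace ℂ L)] [∀ x, TopologicalSpace (L x)]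
    [FiberBundle ℂ L] [VectorBundle ℂ ℂ L] [ContMDiffVectorBundle ω ℂ L 𝓘(ℂ, Model n)]
    (K : KahlerForm n M) (h : HermitianMetric n L)
    (hquant : IsQuantum K h) (hample : IsVeryAmple n L) :
    ∃ _ : FiniteDimensional ℂ (GammaHol K h),
      (∀ x, 0 < epsilon K h x) ∧ Continuous (epsilon K h) ∧
      (∀ A : GammaHol K h →ₗ[ℂ] GammaHol K h,
        ContMDiff 𝓘(ℝ, Model n) 𝓘(ℝ, ℂ) ∞ (covariantSymbol K h A)) ∧
      ∀ (A : GammaHol K h →ₗ[ℂ] GammaHol K h) (f : C^∞⟮𝓘(ℝ, Model n), M; 𝓘(ℝ, ℂ), ℂ⟯),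
        Integrable (fun x => conj (covariantSymbol K h A x) * f x) (liouvilleEps K h) ∧
        hsInner K h A (toeplitz K h f) = epsInner K h (covariantSymbol K h A) f := by
  have hfin := finiteDimensional_gammaHol K h
  have hpos : ∀ x, 0 < epsilon K h x := fun x => epsilon_pos K h (hample.base_point_free x)
  refine ⟨hfin, hpos, continuous_epsilon K h, contMDiff_covariantSymbol K h hpos, fun A f =>
    ⟨integrable_liouvilleEps K h ?_, hsInner_toeplitz K h hpos A f⟩⟩
  exact (Complex.continuous_conj.comp (contMDiff_covariantSymbol K h hpos A).continuous).mul
    f.contMDiff.continuous
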